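/- Let $\mathcal P$ be a countable set with a map $N:\mathcal P\to\mathbb Z_{>1}$, let $\mathcal M$ be the free abelian monoid generated by $\mathcal P$, write $\mathfrak m=\sum_{\mathfrak p\in\mathcal P} n_{\mathfrak p}(\mathfrak m)\,\mathfrak p$ for $\mathfrak m\in\mathcal M$, and extend $N$ to $\mathcal M$ by $N(\mathfrak m)=\prod_{\mathfrak p} N(\mathfrak p)^{n_{\mathfrak p}(\mathfrak m)}$. Let $\omega(\mathfrak m)=|\{\mathfrak p\in\mathcal P: n_{\mathfrak p}(\mathfrak m)\ge 1\}|$. Let $X\subseteq\mathbb Q$ contain $N(\mathcal M)$ and satisfy $x_1/x_2\in X$ whenever $x_1,x_2\in X$, $x_2\neq 0$ (for instance $X=\mathbb Q$, or $X=\{q^z:z\in\mathbb Z\}$ with an integer $q\ge 2$ if $N(\mathcal M)\subseteq X$). All asymptotic relations below are for $x\to\infty$, $x\in X$. Suppose that $$|\{\mathfrak m\in\mathcal M: N(\mathfrak m)\le x\}|=\kappa x+O(x^\theta)\quad\text{for some }\kappa>0\text{ and }0\le\theta<1.\tag{$\star$}$$ Let $\mathcal S\subseteq\mathcal M$ be infinite,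 put $\mathcal S(t)=\{\mathfrak m\in\mathcal S: N(\mathfrak m)\le t\}$ for real $t$, and assume $|\mathcal S(x^{1/2})|=o(|\mathcal S(x)|)$. Let $f:\mathcal S\to\mathcal M$, and let $\lambda_\ell$ ($\ell\in\mathcal P$) be real numbers. For distinct $\ell_1,\dots,\ell_u\in\mathcal P$ define $e_{\ell_1\cdots\ell_u}=e_{\ell_1\cdots\ell_u}(x)$ by $$\frac{1}{|\mathcal S(x)|}\,\bigl|\{\mathfrak m\in\mathcal S(x): n_{\ell_i}(f(\mathfrak m))\ge 1\text{ for all }i=1,\dots,u\}\bigr|=\lambda_{\ell_1}\cdots\lambda_{\ell_u}+e_{\ell_1\cdots\ell_u}(x).$$ Suppose there exist $\beta$ with $0<\beta\le 1$ and a real function $y=y(x)<x^\beta$ such that: (a) $|\{\ell\in\mathcal P: N(\ell)>x^\beta,\ n_\ell(f(\mathfrak m))\ge 1\}|=O(1)$, uniformly for $\mathfrak m\in\mathcal S(x)$; (b) $\sum_{y<N(\ell)\le x^\beta}\lambda_\ell=o\bigl((\log\log x)^{1/2}\bigr)$; (c) $\sum_{y<N(\ell)\le x^\beta}|e_\ell|=o\bigl((\log\log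 x)^{1/2}\bigr)$; (d) $\sum_{N(\ell)\le y}\lambda_\ell=\log\log x+o\bigl((\log\log x)^{1/2}\bigr)$; (e) $\sum_{N(\ell)\le y}\lambda_\ell^2=o\bigl((\log\log x)^{1/2}\bigr)$; (f) for all integers $r\ge 1$ and $1\le u\le r$, $\sum|e_{\ell_1\cdots\ell_u}|=o\bigl((\log\log x)^{-r/2}\bigr)$, where the sum is over all $u$-tuples $(\ell_1,\dots,\ell_u)$ of distinct elements of $\mathcal P$ with $N(\ell_i)\le y$ for all $i$. Then for every $\gamma\in\mathbb R$, $$\lim_{\substack{x\to\infty\\ x\in X}}\frac{1}{|\mathcal S(x)|}\left|\left\{\mathfrak m\in\mathcal S(x): N(\mathfrak m)\ge 3,\ \frac{\omega(f(\mathfrak m))-\log\log N(\mathfrak m)}{\sqrt{\log\log N(\mathfrak m)}}\le\gamma\right\}\right|=\Phi(\gamma):=\frac{1}{\sqrt{2\pi}}\int_{-\infty}^{\gamma}e^{-u^2/2}\,du.$$ -/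

import Mathlib

open Filter Topology Asymptotics

namespace ErdosKac

/-- The norm on the free abelian monoid `P →₀ ℕ`: `N(m) = ∏ N(p) ^ n_p(m)`, where the coefficient
`n_p(m)` is `m p`. -/
def norm {P : Type*} (N : P → ℕ) (m : P →₀ ℕ) : ℕ :=
  m.prod fun p n => N p ^ n

/-- `ω(m)`, the number of `p` with `n_p(m) ≥ 1`. -/
def omega {P : Type*} (m : P →₀ ℕ) : ℕ :=
  m.support.card

/-- The filter describing `x → ∞` with `x ∈ X`. -/
def toInfty (X : Set ℚ) : Filter ℚ :=
  atTop ⊓ 𝓟 X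

/-- `S(t)`, the elements of `S` of norm at most `t`. -/
def upTo {P : Type*} (N : P → ℕ) (S : Set (P →₀ ℕ)) (t : ℝ) : Set S :=
  {m : S | (norm N (m : P →₀ ℕ) : ℝ) ≤ t}

/-- The proportion of the elements of `S(t)` that satisfy `p`. -/
noncomputable def proportion {P : Type*} (N : P → ℕ) (S : Set (P →₀ ℕ)) (t : ℝ)
    (p : S → Prop) : ℝ :=
  ({m : S | m ∈ upTo N S t ∧ p m}.ncard : ℝ) / ((upTo N S t).ncard : ℝ)

/-- The error term `e_{ℓ₁ ⋯ ℓᵤ}(t)`: the proportion of `m ∈ S(t)` with `n_{ℓᵢ}(f(m)) ≥ 1` for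
all `i`, minus `λ_{ℓ₁} ⋯ λ_{ℓᵤ}`. -/
noncomputable def err {P : Type*} (N : P → ℕ) (S : Set (P →₀ ℕ)) (f : S → (P →₀ ℕ))
    (lam : P → ℝ) {u : ℕ} (l : Fin u → P) (t : ℝ) : ℝ :=
  proportion N S t (fun m => ∀ i, 1 ≤ f m (l i)) - ∏ i, lam (l i)

/-- The standard normal distribution function. -/
noncomputable def Phi (γ : ℝ) : ℝ :=
  1 / Real.sqrt (2 * Real.pi) * ∫ u in Set.Iic γ, Real.exp (-u ^ 2 / 2)

end ErdosKac

/-!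
Let `m` be uniform in `S(x)` and put `L = log log x`. By (f), the events `ℓ ∣ f(m)` with `N(ℓ) ≤ y`
have the joint probabilities of independent events of probability `λ_ℓ`, up to errors smaller than
any power of `L`. The factorial moments of the number `W` of events that occur, and with them the
moments of `(W - L) / √L`, are therefore asymptotically those of the independent model. In the model
the moment generating function is `exp (-z √L) ∏ (1 + λ_ℓ (exp (z / √L) - 1))`, which tends to
`exp (z² / 2)` for every complex `z` because `∑ λ_ℓ = L + o(√L)` and `∑ λ_ℓ² = o(√L)`. Bounded
exponential moments in the model turn the agreement of moments into agreement of characteristic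
functions, and Lévy's continuity theorem gives the normal law for `W`.

Passing from `W` to `ω(f(m))` costs `o(√L)` in probability for `y < N(ℓ) ≤ x ^ β` (Markov's
inequality) and `O(1)` beyond. All but a proportion `o(1)` of the `m` have norm above `x ^ (1/2)`,
for which `log log N(m) = L + O(1)`.
-/

namespace ErdosKac

open MeasureTheory ProbabilityTheory
open scoped Nat

/-! ### Comparing characteristic functions through moments -/

lemma norm_charFun_sub_sum_moment_le {μ : Measure ℝ} [IsFiniteMeasure μ] {n : ℕ}
    (hμ : MemLp id (n + 1 : ℕ) μ) (t : ℝ) :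
    ‖charFun μ t
        - ∑ k ∈ Finset.range (n + 1), (k ! : ℂ)⁻¹ * (t * Complex.I) ^ k * (∫ x, x ^ k ∂μ : ℝ)‖
      ≤ |t| ^ (n + 1) / n ! * ∫ x, |x| ^ (n + 1) ∂μ := by
  rcases eq_or_ne t 0 with rfl | ht
  · simp [Finset.sum_range_succ']
  have hμ' : MemLp id n μ := hμ.mono_exponent (by gcongr; simp)
  have hC : ContDiff ℝ (n + 1 : ℕ) (charFun μ) := contDiff_charFun hμ
  have hderiv : ∀ k ≤ n + 1, ∀ s ∈ Set.uIcc 0 t,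
      iteratedDerivWithin k (charFun μ) (Set.uIcc 0 t) s = iteratedDeriv k (charFun μ) s :=
    fun k hk s hs => iteratedDerivWithin_eq_iteratedDeriv (uniqueDiffOn_uIcc ht.symm)
      (hC.contDiffAt.of_le (mod_cast hk)) hs
  have hpoly : taylorWithinEval (charFun μ) n (Set.uIcc 0 t) 0 t
      = taylorWithinEval (charFun μ) n Set.univ 0 t := by
    simp only [taylor_within_apply, iteratedDerivWithin_univ]
    refine Finset.sum_congr rfl fun k hk => ?_
    rw [hderiv k (Finset.mem_range.1 hk).le 0 Set.left_mem_uIcc]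
  rw [← taylorWithinEval_charFun_zero hμ', ← hpoly, taylor_integral_remainder hC.contDiffOn]
  refine (intervalIntegral.norm_integral_le_of_norm_le_const
    (C := |t| ^ n / n ! * ∫ x, |x| ^ (n + 1) ∂μ) fun s hs => ?_).trans_eq (by simp; ring)
  rw [hderiv _ le_rfl s (Set.uIoc_subset_uIcc hs), norm_smul, iteratedDeriv_charFun hμ,
    norm_mul, norm_pow, Complex.norm_I, one_pow, one_mul, norm_div, norm_pow, Real.norm_eq_abs,
    Real.norm_natCast]
  have hts : |t - s| ≤ |t| := by
    simpa using Set.abs_sub_right_of_mem_uIcc (Set.uIoc_subset_uIcc hs)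
  refine mul_le_mul (by gcongr) ((norm_integral_le_integral_norm _).trans_eq ?_)
    (norm_nonneg _) (by positivity)
  exact integral_congr_ae (.of_forall fun x => by simp [Complex.norm_exp])

lemma norm_charFun_sub_charFun_le {μ ν : Measure ℝ} [IsFiniteMeasure μ] [IsFiniteMeasure ν] {n : ℕ}
    (hn : Even (n + 1)) (hμ : MemLp id (n + 1 : ℕ) μ) (hν : MemLp id (n + 1 : ℕ) ν) (t : ℝ) :
    ‖charFun μ t - charFun ν t‖
      ≤ ∑ k ∈ Finset.range (n + 1), |t| ^ k / k ! * |∫ x, x ^ k ∂μ - ∫ x, x ^ k ∂ν|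
        + |t| ^ (n + 1) / n ! * |∫ x, x ^ (n + 1) ∂μ - ∫ x, x ^ (n + 1) ∂ν|
        + 2 * (|t| ^ (n + 1) / n ! * ∫ x, x ^ (n + 1) ∂ν) := by
  have hμt := norm_charFun_sub_sum_moment_le hμ t
  have hνt := norm_charFun_sub_sum_moment_le hν t
  simp only [hn.pow_abs] at hμt hνt ⊢
  set p := ∑ k ∈ Finset.range (n + 1), (k ! : ℂ)⁻¹ * (t * Complex.I) ^ k *
    (∫ x, x ^ k ∂μ : ℝ) with hp
  set q := ∑ k ∈ Finset.range (n + 1), (k ! : ℂ)⁻¹ * (t * Complex.I) ^ k *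
    (∫ x, x ^ k ∂ν : ℝ) with hq
  have hpq : ‖p - q‖
      ≤ ∑ k ∈ Finset.range (n + 1), |t| ^ k / k ! * |∫ x, x ^ k ∂μ - ∫ x, x ^ k ∂ν| := by
    rw [hp, hq, ← Finset.sum_sub_distrib]
    refine norm_sum_le_of_le _ fun k _ => le_of_eq ?_
    rw [← mul_sub, ← Complex.ofReal_sub, norm_mul, Complex.norm_real, Real.norm_eq_abs]
    simp [div_eq_inv_mul]
  have htri : ‖charFun μ t - charFun ν t‖
      ≤ ‖charFun μ t - p‖ + ‖p - q‖ + ‖charFun ν t - q‖ := by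
    calc _ = ‖(charFun μ t - p) + (p - q) - (charFun ν t - q)‖ := by congr 1; ring
      _ ≤ _ := (norm_sub_le _ _).trans (by gcongr; exact norm_add_le _ _)
  have hle : t ^ (n + 1) / n ! * ∫ x, x ^ (n + 1) ∂μ
      ≤ t ^ (n + 1) / n ! * (|∫ x, x ^ (n + 1) ∂μ - ∫ x, x ^ (n + 1) ∂ν|
        + ∫ x, x ^ (n + 1) ∂ν) := by
    have := hn.pow_nonneg t
    gcongr
    linarith [le_abs_self (∫ x, x ^ (n + 1) ∂μ - ∫ x, x ^ (n + 1) ∂ν)]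
  linarith

lemma pow_div_factorial_le_exp_add_exp_neg {n : ℕ} (hn : Even n) (v : ℝ) :
    v ^ n / n ! ≤ Real.exp v + Real.exp (-v) := by
  rw [← hn.pow_abs]
  refine (Real.pow_div_factorial_le_exp _ (abs_nonneg v) n).trans ?_
  rcases abs_cases v with ⟨h, -⟩ | ⟨h, -⟩ <;> rw [h]
  · exact le_add_of_nonneg_right (Real.exp_pos _).le
  · exact le_add_of_nonneg_left (Real.exp_pos _).le

lemma mul_pow_div_factorial_mul_moment_le {ν : Measure ℝ} {n : ℕ} (hn : Even n)
    (hν : ∀ s, Integrable (fun x => Real.exp (s * x)) ν) (s : ℝ) :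
    s ^ n / n ! * ∫ x, x ^ n ∂ν ≤ mgf id ν s + mgf id ν (-s) := by
  simp only [mgf, id_eq]
  rw [← integral_add (hν s) (hν (-s)), ← integral_const_mul]
  refine integral_mono_of_nonneg (.of_forall fun x => ?_) ((hν s).add (hν (-s)))
    (.of_forall fun x => ?_)
  · have := hn.pow_nonneg x
    have := hn.pow_nonneg s
    simp only [Pi.zero_apply]
    positivity
  · simpa [mul_pow, div_mul_eq_mul_div] using pow_div_factorial_le_exp_add_exp_neg hn (s * x)

lemma exists_even_eventually_moment_le {α : Type*} {F : Filter α} {ν : α → Measure ℝ}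
    (hν : ∀ᶠ a in F, ∀ s, Integrable (fun x => Real.exp (s * x)) (ν a))
    (hexp : ∀ s, F.IsBoundedUnder (· ≤ ·) fun a => mgf id (ν a) s) (t : ℝ) {ε : ℝ} (hε : 0 < ε) :
    ∃ n : ℕ, Even (n + 1) ∧
      ∀ᶠ a in F, |t| ^ (n + 1) / n ! * ∫ x, x ^ (n + 1) ∂ν a ≤ ε := by
  obtain ⟨s, hs, hts⟩ : ∃ s, 0 < s ∧ |t| / s < 1 :=
    ⟨|t| + 1, by positivity, (div_lt_one (by positivity)).2 (lt_add_one _)⟩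
  obtain ⟨C, hC⟩ := hexp s
  obtain ⟨D, hD⟩ := hexp (-s)
  have hlim : Tendsto (fun k : ℕ => k * (|t| / s) ^ k * (C + D)) atTop (𝓝 0) := by
    simpa using (tendsto_self_mul_const_pow_of_lt_one (by positivity) hts).mul_const (C + D)
  obtain ⟨k, hk, hkε, hk0⟩ := ((Nat.frequently_even).and_eventually
    ((hlim.eventually_le_const hε).and (eventually_gt_atTop 0))).exists
  obtain ⟨n, rfl⟩ := Nat.exists_eq_add_one.2 hk0
  refine ⟨n, hk, ?_⟩
  filter_upwards [hν, eventually_map.1 hC, eventually_map.1 hD] with a ha haC haD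
  calc |t| ^ (n + 1) / n ! * ∫ x, x ^ (n + 1) ∂ν a
      = ((n + 1 : ℕ) * (|t| / s) ^ (n + 1))
          * (s ^ (n + 1) / (n + 1)! * ∫ x, x ^ (n + 1) ∂ν a) := by
        rw [Nat.factorial_succ, div_pow]
        push_cast
        field_simp
    _ ≤ ((n + 1 : ℕ) * (|t| / s) ^ (n + 1)) * (C + D) := by
        gcongr
        exact (mul_pow_div_factorial_mul_moment_le hk ha s).trans (add_le_add haC haD)
    _ ≤ ε := hkε

theorem tendsto_charFun_sub_of_tendsto_moment_sub {α : Type*} {F : Filter α}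
    {μ ν : α → Measure ℝ} (hμfin : ∀ᶠ a in F, IsFiniteMeasure (μ a))
    (hνfin : ∀ᶠ a in F, IsFiniteMeasure (ν a)) (hμ : ∀ᶠ a in F, ∀ n : ℕ, MemLp id n (μ a))
    (hν : ∀ᶠ a in F, ∀ s, Integrable (fun x => Real.exp (s * x)) (ν a))
    (hmom : ∀ k : ℕ, Tendsto (fun a => ∫ x, x ^ k ∂μ a - ∫ x, x ^ k ∂ν a) F (𝓝 0))
    (hexp : ∀ s, F.IsBoundedUnder (· ≤ ·) fun a => mgf id (ν a) s) (t : ℝ) :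
    Tendsto (fun a => charFun (μ a) t - charFun (ν a) t) F (𝓝 0) := by
  rw [Metric.tendsto_nhds]
  intro ε hε
  obtain ⟨n, hn, htail⟩ := exists_even_eventually_moment_le hν hexp t (ε := ε / 4) (by positivity)
  have habs : ∀ k : ℕ, Tendsto (fun a => |∫ x, x ^ k ∂μ a - ∫ x, x ^ k ∂ν a|) F (𝓝 0) :=
    fun k => by simpa using (hmom k).abs
  have hmain : Tendsto (fun a =>
      ∑ k ∈ Finset.range (n + 1), |t| ^ k / k ! * |∫ x, x ^ k ∂μ a - ∫ x, x ^ k ∂ν a|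
        + |t| ^ (n + 1) / n ! * |∫ x, x ^ (n + 1) ∂μ a - ∫ x, x ^ (n + 1) ∂ν a|) F (𝓝 0) := by
    simpa using (tendsto_finsetSum _ fun k _ => (habs k).const_mul (|t| ^ k / k !)).add
      ((habs (n + 1)).const_mul (|t| ^ (n + 1) / n !))
  filter_upwards [hμfin, hνfin, hμ, hν, htail, hmain.eventually_lt_const (half_pos hε)]
    with a hμa hνa hμa' hνa' htail hmain
  have hνa'' : MemLp id (n + 1 : ℕ) (ν a) := memLp_of_mem_interior_integrableExpSet
    (by rw [show integrableExpSet id (ν a) = Set.univ from Set.eq_univ_of_forall hνa',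
      interior_univ]; trivial) (n + 1 : ℕ)
  rw [dist_zero_right]
  linarith [norm_charFun_sub_charFun_le hn (hμa' (n + 1)) hνa'' t]

/-! ### Factorial moments -/

lemma pow_eq_sum_stirlingSecond_mul_descFactorial (n k : ℕ) :
    n ^ k = ∑ u ∈ Finset.range (k + 1), k.stirlingSecond u * n.descFactorial u := by
  induction k with
  | zero => simp
  | succ k ih =>
    have hmul : ∀ u, n.descFactorial u * n = n.descFactorial (u + 1) + u * n.descFactorial u := by
      intro u
      rcases le_or_gt u n with hu | hu
      · rw [Nat.descFactorial_succ, ← add_mul, Nat.sub_add_cancel hu, mul_comm]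
      · simp [Nat.descFactorial_of_lt hu]
    have hshift : ∑ u ∈ Finset.range (k + 1),
        (u + 1) * k.stirlingSecond (u + 1) * n.descFactorial (u + 1)
        = ∑ u ∈ Finset.range (k + 1), u * k.stirlingSecond u * n.descFactorial u := by
      rw [Finset.sum_range_succ, Finset.sum_range_succ',
        Nat.stirlingSecond_eq_zero_of_lt k.lt_succ_self]
      simp
    rw [pow_succ, ih, Finset.sum_mul, Finset.sum_range_succ' _ (k + 1)]
    simp only [mul_assoc, hmul, mul_add, Finset.sum_add_distrib, Nat.stirlingSecond_succ_succ,
      add_mul, Nat.stirlingSecond_succ_zero, zero_mul, add_zero] at hshift ⊢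
    rw [hshift, add_comm]
    simp only [mul_left_comm]

lemma integral_sub_pow_eq_sum_descFactorial {ρ : Measure ℕ}
    (hρ : ∀ u : ℕ, Integrable (fun n : ℕ => (n.descFactorial u : ℝ)) ρ) (c : ℝ) (k : ℕ) :
    ∫ n : ℕ, ((n : ℝ) - c) ^ k ∂ρ = ∑ j ∈ Finset.range (k + 1), ∑ u ∈ Finset.range (j + 1),
      (-c) ^ (k - j) * (k.choose j * j.stirlingSecond u) * ∫ n : ℕ, (n.descFactorial u : ℝ) ∂ρ := by
  have hpow : ∀ n : ℕ, ((n : ℝ) - c) ^ k = ∑ j ∈ Finset.range (k + 1),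
      ∑ u ∈ Finset.range (j + 1),
        (-c) ^ (k - j) * (k.choose j * j.stirlingSecond u) * (n.descFactorial u : ℝ) := by
    intro n
    rw [sub_eq_add_neg, add_pow]
    refine Finset.sum_congr rfl fun j _ => ?_
    rw [← Nat.cast_pow, pow_eq_sum_stirlingSecond_mul_descFactorial]
    push_cast
    rw [Finset.sum_mul, Finset.sum_mul]
    exact Finset.sum_congr rfl fun u _ => by ring
  simp only [hpow]
  rw [integral_finsetSum _ fun j _ => integrable_finsetSum _ fun u _ => (hρ u).const_mul _]
  refine Finset.sum_congr rfl fun j _ => ?_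
  rw [integral_finsetSum _ fun u _ => (hρ u).const_mul _]
  exact Finset.sum_congr rfl fun u _ => integral_const_mul _ _

lemma superpolynomialDecay_sum {α ι : Type*} {F : Filter α} {L : α → ℝ} {s : Finset ι}
    {g : ι → α → ℝ} (h : ∀ i ∈ s, SuperpolynomialDecay F L (g i)) :
    SuperpolynomialDecay F L fun a => ∑ i ∈ s, g i a := by
  intro n
  simpa [Finset.mul_sum] using tendsto_finsetSum s fun i hi => h i hi n

lemma superpolynomialDecay_integral_sub_pow_sub {α : Type*} {F : Filter α} {L : α → ℝ}
    {ρ σ : α → Measure ℕ}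
    (hρ : ∀ᶠ a in F, ∀ u : ℕ, Integrable (fun n : ℕ => (n.descFactorial u : ℝ)) (ρ a))
    (hσ : ∀ᶠ a in F, ∀ u : ℕ, Integrable (fun n : ℕ => (n.descFactorial u : ℝ)) (σ a))
    (h : ∀ u : ℕ, SuperpolynomialDecay F L fun a =>
      ∫ n : ℕ, (n.descFactorial u : ℝ) ∂ρ a - ∫ n : ℕ, (n.descFactorial u : ℝ) ∂σ a) (k : ℕ) :
    SuperpolynomialDecay F L fun a =>
      ∫ n : ℕ, ((n : ℝ) - L a) ^ k ∂ρ a - ∫ n : ℕ, ((n : ℝ) - L a) ^ k ∂σ a := by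
  have hsum := superpolynomialDecay_sum (s := Finset.range (k + 1)) fun j _ =>
    superpolynomialDecay_sum (s := Finset.range (j + 1)) fun u _ =>
      ((h u).param_pow_mul (k - j)).const_mul ((-1) ^ (k - j) * (k.choose j * j.stirlingSecond u))
  refine hsum.congr' ?_
  filter_upwards [hρ, hσ] with a ha hb
  rw [integral_sub_pow_eq_sum_descFactorial ha, integral_sub_pow_eq_sum_descFactorial hb,
    ← Finset.sum_sub_distrib]
  refine Finset.sum_congr rfl fun j _ => ?_
  rw [← Finset.sum_sub_distrib]
  refine Finset.sum_congr rfl fun u _ => ?_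
  simp only [Pi.mul_apply, Pi.pow_apply]
  rw [neg_pow (L a)]
  ring

lemma superpolynomialDecay_of_isLittleO_rpow {α : Type*} {F : Filter α}
    {L g : α → ℝ} (hL : Tendsto L F atTop) {u : ℕ}
    (h : ∀ r : ℕ, u ≤ r → g =o[F] fun a => L a ^ (-(r : ℝ) / 2)) : SuperpolynomialDecay F L g := by
  rw [superpolynomialDecay_iff_isLittleO _ hL]
  intro z
  refine (h (u + 2 * z.natAbs) (Nat.le_add_right _ _)).trans_isBigO (.of_bound 1 ?_)
  filter_upwards [hL.eventually_ge_atTop 1] with a ha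
  rw [one_mul, ← Real.rpow_intCast, Real.norm_of_nonneg (by positivity),
    Real.norm_of_nonneg (by positivity)]
  refine Real.rpow_le_rpow_of_exponent_le ha ?_
  have hz : -(z.natAbs : ℝ) ≤ z := by
    rw [Nat.cast_natAbs, Int.cast_abs]
    exact neg_abs_le _
  push_cast
  linarith [(u.cast_nonneg : (0 : ℝ) ≤ u)]

/-! ### Counting events -/

open Classical in
/-- The injective `u`-tuples with entries in `T`. Summing joint probabilities over them gives the
`u`-th factorial moment of a count of events. -/
noncomputable def injTuples {P : Type*} (T : Finset P) (u : ℕ) : Finset (Fin u → P) :=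
  {l ∈ Fintype.piFinset fun _ => T | Function.Injective l}

lemma mem_injTuples {P : Type*} {T : Finset P} {u : ℕ} {l : Fin u → P} :
    l ∈ injTuples T u ↔ (∀ i, l i ∈ T) ∧ Function.Injective l := by
  simp [injTuples, Fintype.mem_piFinset]

lemma card_injTuples {P : Type*} (T : Finset P) (u : ℕ) :
    (injTuples T u).card = T.card.descFactorial u := by
  classical
  have h : Fintype.card (Fin u ↪ T) = T.card.descFactorial u := by
    simp [Fintype.card_embedding_eq]
  rw [← h, ← Finset.card_univ]
  refine Finset.card_bij' (fun l hl => ⟨fun i => ⟨l i, (mem_injTuples.1 hl).1 i⟩, fun i j hij =>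
    (mem_injTuples.1 hl).2 (congrArg Subtype.val hij)⟩) (fun e _ i => (e i : P)) ?_ ?_ ?_ ?_
  · simp
  · exact fun e _ => mem_injTuples.2 ⟨fun i => (e i).2, Subtype.val_injective.comp e.injective⟩
  · exact fun _ _ => rfl
  · exact fun _ _ => rfl

section Events

variable {Ω P : Type*}

open Classical in
/-- The number of the events `E l`, `l ∈ T`, that occur. With `E l` the event `ℓ ∣ f(m)` and `T`
given by `N(ℓ) ≤ y`, this is the part of `ω(f(m))` compared with an independent model. -/
noncomputable def eventCount (E : P → Set Ω) (T : Finset P) (ω : Ω) : ℕ :=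
  Finset.card {l ∈ T | ω ∈ E l}

lemma eventCount_le_card (E : P → Set Ω) (T : Finset P) (ω : Ω) : eventCount E T ω ≤ T.card := by
  classical exact Finset.card_filter_le _ _

lemma eventCount_eq_sum_indicator (E : P → Set Ω) (T : Finset P) (ω : Ω) :
    eventCount E T ω = ∑ l ∈ T, (E l).indicator 1 ω := by
  classical
  simp only [eventCount, Finset.card_filter, Set.indicator_apply, Pi.one_apply]

lemma descFactorial_eventCount (E : P → Set Ω) (T : Finset P) (u : ℕ) (ω : Ω) :
    ((eventCount E T ω).descFactorial u : ℝ)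
      = ∑ l ∈ injTuples T u, (⋂ j, E (l j)).indicator 1 ω := by
  classical
  rw [eventCount, ← card_injTuples]
  simp only [Set.indicator_apply, Pi.one_apply, ← Finset.sum_filter, Finset.sum_const,
    Set.mem_iInter, nsmul_one]
  congr 2
  ext l
  simp only [mem_injTuples, Finset.mem_filter, forall_and]
  tauto

lemma prod_indicator_const {R : Type*} [CommMonoidWithZero R] (E : P → Set Ω) (A : Finset P)
    (c : R) (ω : Ω) :
    ∏ l ∈ A, (E l).indicator (fun _ => c) ω
      = (⋂ l ∈ A, E l).indicator (fun _ => c ^ A.card) ω := by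
  by_cases h : ω ∈ ⋂ l ∈ A, E l
  · rw [Set.indicator_of_mem h, ← Finset.prod_const]
    exact Finset.prod_congr rfl fun l hl => Set.indicator_of_mem (Set.mem_iInter₂.1 h l hl) _
  · rw [Set.indicator_of_notMem h]
    simp only [Set.mem_iInter, not_forall] at h
    obtain ⟨l, hl, hω⟩ := h
    exact Finset.prod_eq_zero hl (Set.indicator_of_notMem hω _)

lemma exp_mul_eventCount (E : P → Set Ω) (T : Finset P) (z : ℂ) (ω : Ω) :
    Complex.exp (z * eventCount E T ω)
      = ∑ A ∈ T.powerset, (⋂ l ∈ A, E l).indicator (fun _ => (Complex.exp z - 1) ^ A.card) ω := by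
  simp only [← prod_indicator_const, ← Finset.prod_one_add, eventCount_eq_sum_indicator]
  push_cast
  rw [Finset.mul_sum, Complex.exp_sum]
  refine Finset.prod_congr rfl fun l _ => ?_
  by_cases h : ω ∈ E l <;> simp [h]

variable [MeasurableSpace Ω] {μ : Measure Ω} {E : P → Set Ω}

lemma measurable_eventCount (hE : ∀ l, MeasurableSet (E l)) (T : Finset P) :
    Measurable (eventCount E T) := by
  simp only [funext (eventCount_eq_sum_indicator E T)]
  exact Finset.measurable_sum _ fun l _ => measurable_one.indicator (hE l)

lemma integrable_map_eventCount [IsFiniteMeasure μ] (hE : ∀ l, MeasurableSet (E l)) (T : Finset P)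
    (g : ℕ → ℝ) : Integrable g (μ.map (eventCount E T)) := by
  refine (integrable_map_measure Measurable.of_discrete.aestronglyMeasurable
    (measurable_eventCount hE T).aemeasurable).2 ?_
  refine .of_bound (Measurable.of_discrete.comp (measurable_eventCount hE T)).aestronglyMeasurable
    (∑ n ∈ Finset.range (T.card + 1), ‖g n‖) (.of_forall fun ω => ?_)
  exact Finset.single_le_sum (f := fun n => ‖g n‖) (fun n _ => norm_nonneg _)
    (Finset.mem_range_succ_iff.2 (eventCount_le_card E T ω))

lemma integral_descFactorial_map_eventCount [IsFiniteMeasure μ] (hE : ∀ l, MeasurableSet (E l))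
    (T : Finset P) (u : ℕ) :
    ∫ n : ℕ, (n.descFactorial u : ℝ) ∂μ.map (eventCount E T)
      = ∑ l ∈ injTuples T u, μ.real (⋂ j, E (l j)) := by
  have hmeas : ∀ l : Fin u → P, MeasurableSet (⋂ j, E (l j)) :=
    fun l => .iInter fun j => hE (l j)
  rw [integral_map (measurable_eventCount hE T).aemeasurable
    Measurable.of_discrete.aestronglyMeasurable]
  simp only [descFactorial_eventCount]
  rw [integral_finsetSum _ fun l _ => (integrable_const 1).indicator (hmeas l)]
  exact Finset.sum_congr rfl fun l _ => integral_indicator_one (hmeas l)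

lemma integral_exp_mul_map_eventCount [IsFiniteMeasure μ] (hE : ∀ l, MeasurableSet (E l))
    (hind : iIndepSet E μ) (T : Finset P) (z : ℂ) :
    ∫ n : ℕ, Complex.exp (z * n) ∂μ.map (eventCount E T)
      = ∏ l ∈ T, (1 + μ.real (E l) * (Complex.exp z - 1)) := by
  have hmeas : ∀ A : Finset P, MeasurableSet (⋂ l ∈ A, E l) :=
    fun A => .biInter A.countable_toSet fun l _ => hE l
  rw [integral_map (measurable_eventCount hE T).aemeasurable
    Measurable.of_discrete.aestronglyMeasurable]
  simp only [exp_mul_eventCount]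
  rw [integral_finsetSum _ fun A _ => (integrable_const _).indicator (hmeas A),
    Finset.prod_one_add]
  refine Finset.sum_congr rfl fun A _ => ?_
  rw [integral_indicator_const _ (hmeas A), Finset.prod_mul_distrib, Finset.prod_const,
    measureReal_def, hind.meas_biInter, ENNReal.toReal_prod]
  simp [measureReal_def]

lemma mul_real_lt_eventCount_le {μ : Measure Ω} [IsFiniteMeasure μ] (hE : ∀ l, MeasurableSet (E l))
    (T : Finset P) {δ : ℝ} (hδ : 0 ≤ δ) :
    δ * μ.real {ω | δ < eventCount E T ω} ≤ ∑ l ∈ T, μ.real (E l) := by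
  have hind : ∀ l ∈ T, Integrable ((E l).indicator (1 : Ω → ℝ)) μ := fun l _ =>
    (integrable_const 1).indicator (hE l)
  have hcount : ∀ ω, (eventCount E T ω : ℝ) = ∑ l ∈ T, (E l).indicator (1 : Ω → ℝ) ω := fun ω => by
    rw [eventCount_eq_sum_indicator, Nat.cast_sum]
    exact Finset.sum_congr rfl fun l _ => by
      classical simp only [Set.indicator_apply, Pi.one_apply, Nat.cast_ite, Nat.cast_one,
        Nat.cast_zero]
  calc δ * μ.real {ω | δ < eventCount E T ω}
      ≤ δ * μ.real {ω | δ ≤ eventCount E T ω} :=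
        mul_le_mul_of_nonneg_left (measureReal_mono fun _ => le_of_lt (α := ℝ)) hδ
    _ ≤ ∫ ω, (eventCount E T ω : ℝ) ∂μ :=
        mul_meas_ge_le_integral_of_nonneg (.of_forall fun _ => Nat.cast_nonneg _)
          ((integrable_finsetSum T hind).congr (.of_forall fun ω => (hcount ω).symm)) δ
    _ = ∑ l ∈ T, μ.real (E l) := by
        simp only [hcount, integral_finsetSum T hind, integral_indicator_one (hE _)]

lemma tendsto_real_lt_eventCount {α : Type*} {F : Filter α} {μ : α → Measure Ω}
    (hμ : ∀ᶠ a in F, IsFiniteMeasure (μ a))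
    (hE : ∀ l, MeasurableSet (E l)) {T : α → Finset P} {g : α → ℝ} (hg : ∀ᶠ a in F, 0 < g a)
    (h : (fun a => ∑ l ∈ T a, (μ a).real (E l)) =o[F] g) {δ : ℝ} (hδ : 0 < δ) :
    Tendsto (fun a => (μ a).real {ω | δ * g a < eventCount E (T a) ω}) F (𝓝 0) := by
  have hlim := h.tendsto_div_nhds_zero.const_mul δ⁻¹
  rw [mul_zero] at hlim
  refine squeeze_zero' (.of_forall fun _ => measureReal_nonneg) ?_ hlim
  filter_upwards [hμ, hg] with a _ ha
  rw [inv_mul_eq_div, div_div, mul_comm (g a), le_div_iff₀ (mul_pos hδ ha), mul_comm]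
  exact mul_real_lt_eventCount_le hE (T a) (mul_pos hδ ha).le

end Events

/-! ### The independent model -/

lemma exists_iIndepSet_real_eq.{v} {P : Type v} {lam : P → ℝ} (hlam : ∀ l, lam l ∈ Set.Icc 0 1) :
    ∃ (Ω : Type v) (_ : MeasurableSpace Ω) (μ : Measure Ω) (E : P → Set Ω),
      IsProbabilityMeasure μ ∧ (∀ l, MeasurableSet (E l)) ∧ iIndepSet E μ ∧
        ∀ l, μ.real (E l) = lam l := by
  obtain ⟨Ω, _, μ, X, hX, hlaw, hind, hμ⟩ := exists_hasLaw_indepFun (fun _ : P => Bool)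
    fun l => bernoulliMeasure true false (⟨lam l, hlam l⟩ : unitInterval)
  have hE : ∀ l, MeasurableSet (X l ⁻¹' {true}) := fun l => hX l (measurableSet_singleton _)
  refine ⟨Ω, _, μ, fun l => X l ⁻¹' {true}, hμ, hE, ?_, fun l => ?_⟩
  · exact (iIndepSet_iff_meas_biInter hE).2 fun A =>
      hind.meas_biInter fun l _ => ⟨{true}, measurableSet_singleton _, rfl⟩
  · rw [← map_measureReal_apply (hX l) (measurableSet_singleton _), (hlaw l).map_eq,
      bernoulliMeasure_real_apply _ (measurableSet_singleton _)]
    simp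

lemma tendsto_div_ofReal_atTop (z : ℂ) : Tendsto (fun s : ℝ => z / s) atTop (𝓝 0) := by
  simpa [div_eq_mul_inv] using
    (tendsto_inv₀_cobounded.comp (RCLike.tendsto_ofReal_atTop_cobounded ℂ)).const_mul z

lemma tendsto_exp_div_sub_one (z : ℂ) :
    Tendsto (fun s : ℝ => Complex.exp (z / s) - 1) atTop (𝓝 0) := by
  simpa using (tendsto_div_ofReal_atTop z).cexp.sub_const 1

lemma tendsto_sq_mul_exp_div_sub_one_sub (z : ℂ) :
    Tendsto (fun s : ℝ => (s : ℂ) ^ 2 * (Complex.exp (z / s) - 1) - z * s) atTop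
      (𝓝 (z ^ 2 / 2)) := by
  have hO : (fun s : ℝ => (s : ℂ) ^ 2 * (z / s) ^ 2) =O[atTop] fun _ => z ^ 2 := by
    refine .of_bound 1 ?_
    filter_upwards [eventually_ne_atTop 0] with s hs
    have hs' : (s : ℂ) ≠ 0 := Complex.ofReal_ne_zero.2 hs
    rw [div_pow, mul_div_cancel₀ _ (pow_ne_zero 2 hs'), one_mul]
  have hrem := ((isBigO_refl (fun s : ℝ => (s : ℂ) ^ 2) atTop).mul_isLittleO
    ((Complex.exp_sub_sum_range_succ_isLittleO_pow 2).comp_tendsto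
      (tendsto_div_ofReal_atTop z))).trans_isBigO hO
  have h := (hrem.trans_isBigO (isBigO_const_const _ one_ne_zero _)).tendsto_div_nhds_zero.add_const
    (z ^ 2 / 2)
  rw [zero_add] at h
  refine h.congr' ?_
  filter_upwards [eventually_ne_atTop 0] with s hs
  have hs' : (s : ℂ) ≠ 0 := Complex.ofReal_ne_zero.2 hs
  simp only [Finset.sum_range_succ, Finset.sum_range_zero, Function.comp_apply, Nat.factorial,
    Nat.cast_one, Nat.cast_ofNat, Nat.succ_eq_add_one, Nat.mul_one, Nat.reduceAdd, pow_zero,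
    pow_one]
  field_simp
  ring

lemma tendsto_mul_exp_div_sub_one (z : ℂ) :
    Tendsto (fun s : ℝ => (s : ℂ) * (Complex.exp (z / s) - 1)) atTop (𝓝 z) := by
  have h := ((tendsto_inv₀_cobounded.comp (RCLike.tendsto_ofReal_atTop_cobounded ℂ)).mul
    (tendsto_sq_mul_exp_div_sub_one_sub z)).add_const z
  rw [zero_mul, zero_add] at h
  refine h.congr' ?_
  filter_upwards [eventually_ne_atTop 0] with s hs
  have hs' : (s : ℂ) ≠ 0 := Complex.ofReal_ne_zero.2 hs
  simp only [Function.comp_apply, RCLike.ofReal_eq_complex_ofReal]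
  field_simp
  ring

section Limits

variable {α P : Type*} {F : Filter α}

lemma tendsto_mul_exp_div_sqrt_sub_one_sub {L μ : α → ℝ} (hL : Tendsto L F atTop)
    (hμ : (fun a => μ a - L a) =o[F] fun a => √(L a)) (z : ℂ) :
    Tendsto (fun a => (μ a : ℂ) * (Complex.exp (z / √(L a)) - 1) - z * √(L a)) F
      (𝓝 (z ^ 2 / 2)) := by
  have hs : Tendsto (fun a => √(L a)) F atTop := Real.tendsto_sqrt_atTop.comp hL
  have hε : Tendsto (fun a => (((μ a - L a) / √(L a) : ℝ) : ℂ)) F (𝓝 0) :=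
    (Complex.continuous_ofReal.tendsto' 0 0 Complex.ofReal_zero).comp hμ.tendsto_div_nhds_zero
  have h := ((tendsto_sq_mul_exp_div_sub_one_sub z).comp hs).add
    (hε.mul ((tendsto_mul_exp_div_sub_one z).comp hs))
  rw [zero_mul, add_zero] at h
  refine h.congr' ?_
  filter_upwards [hL.eventually_gt_atTop 0] with a ha
  have hs0 : (√(L a) : ℂ) ≠ 0 := Complex.ofReal_ne_zero.2 (Real.sqrt_pos.2 ha).ne'
  have hL0 : (√(L a) : ℂ) ^ 2 = L a := by rw [← Complex.ofReal_pow, Real.sq_sqrt ha.le]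
  simp only [Function.comp_apply, Complex.ofReal_div, Complex.ofReal_sub, ← hL0]
  field_simp
  ring

lemma norm_sum_log_one_add_mul_sub_le {lam : P → ℝ} (hlam : ∀ l, lam l ∈ Set.Icc 0 1)
    (T : Finset P) {b : ℂ} (hb : ‖b‖ ≤ 1 / 2) :
    ‖∑ l ∈ T, Complex.log (1 + lam l * b) - (∑ l ∈ T, lam l : ℝ) * b‖
      ≤ ‖b‖ ^ 2 * ∑ l ∈ T, lam l ^ 2 := by
  rw [Complex.ofReal_sum, Finset.sum_mul, ← Finset.sum_sub_distrib, Finset.mul_sum]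
  refine norm_sum_le_of_le _ fun l _ => ?_
  have hnorm : ‖(lam l : ℂ) * b‖ = lam l * ‖b‖ := by
    rw [norm_mul, Complex.norm_of_nonneg (hlam l).1]
  have hle : lam l * ‖b‖ ≤ 1 / 2 :=
    (mul_le_of_le_one_left (norm_nonneg b) (hlam l).2).trans hb
  have hinv : (1 - lam l * ‖b‖)⁻¹ ≤ 2 := inv_le_of_inv_le₀ (by norm_num) (by linarith)
  calc ‖Complex.log (1 + lam l * b) - lam l * b‖
      ≤ (lam l * ‖b‖) ^ 2 * (1 - lam l * ‖b‖)⁻¹ / 2 := by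
        rw [← hnorm]
        exact Complex.norm_log_one_add_sub_self_le (by rw [hnorm]; linarith)
    _ ≤ (lam l * ‖b‖) ^ 2 * 2 / 2 := by gcongr
    _ = ‖b‖ ^ 2 * lam l ^ 2 := by ring

lemma tendsto_sum_log_one_add_mul_sub {L : α → ℝ} {T : α → Finset P} {lam : P → ℝ}
    (hL : Tendsto L F atTop) (hlam : ∀ l, lam l ∈ Set.Icc 0 1)
    (hsq : (fun a => ∑ l ∈ T a, lam l ^ 2) =o[F] fun a => √(L a)) (z : ℂ) :
    Tendsto (fun a => ∑ l ∈ T a, Complex.log (1 + lam l * (Complex.exp (z / √(L a)) - 1))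
      - (∑ l ∈ T a, lam l : ℝ) * (Complex.exp (z / √(L a)) - 1)) F (𝓝 0) := by
  have hs : Tendsto (fun a => √(L a)) F atTop := Real.tendsto_sqrt_atTop.comp hL
  have hmul := (tendsto_mul_exp_div_sub_one z).comp hs
  have hb : Tendsto (fun a => Complex.exp (z / √(L a)) - 1) F (𝓝 0) :=
    (tendsto_exp_div_sub_one z).comp hs
  refine squeeze_zero_norm' (a := fun a =>
    ‖(√(L a) : ℂ) * (Complex.exp (z / √(L a)) - 1)‖ ^ 2 * ((∑ l ∈ T a, lam l ^ 2) / √(L a))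
      * (√(L a))⁻¹) ?_ ?_
  · filter_upwards [hb.norm.eventually_lt_const (by norm_num : ‖(0 : ℂ)‖ < 1 / 2),
      hs.eventually_gt_atTop 0] with a hba ha
    refine (norm_sum_log_one_add_mul_sub_le hlam (T a) hba.le).trans_eq ?_
    rw [norm_mul, Complex.norm_of_nonneg ha.le]
    field_simp
  · simpa using ((hmul.norm.pow 2).mul hsq.tendsto_div_nhds_zero).mul
      (tendsto_inv_atTop_zero.comp hs)

lemma tendsto_exp_neg_mul_prod_one_add {L : α → ℝ} {T : α → Finset P} {lam : P → ℝ}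
    (hL : Tendsto L F atTop) (hlam : ∀ l, lam l ∈ Set.Icc 0 1)
    (hsum : (fun a => ∑ l ∈ T a, lam l - L a) =o[F] fun a => √(L a))
    (hsq : (fun a => ∑ l ∈ T a, lam l ^ 2) =o[F] fun a => √(L a)) (z : ℂ) :
    Tendsto (fun a => Complex.exp (-(z * √(L a)))
      * ∏ l ∈ T a, (1 + lam l * (Complex.exp (z / √(L a)) - 1))) F
      (𝓝 (Complex.exp (z ^ 2 / 2))) := by
  have h := ((tendsto_sum_log_one_add_mul_sub hL hlam hsq z).add
    (tendsto_mul_exp_div_sqrt_sub_one_sub hL hsum z)).cexp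
  rw [zero_add] at h
  refine h.congr' ?_
  have hb := ((tendsto_exp_div_sub_one z).comp (Real.tendsto_sqrt_atTop.comp hL)).norm
  filter_upwards [hb.eventually_lt_const (by norm_num : ‖(0 : ℂ)‖ < 1)] with a hba
  have hne : ∀ l, 1 + (lam l : ℂ) * (Complex.exp (z / √(L a)) - 1) ≠ 0 := fun l hl => by
    have hle : ‖(lam l : ℂ) * (Complex.exp (z / √(L a)) - 1)‖ < 1 := by
      rw [norm_mul, Complex.norm_of_nonneg (hlam l).1]
      exact (mul_le_of_le_one_left (norm_nonneg _) (hlam l).2).trans_lt hba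
    rw [eq_neg_of_add_eq_zero_right hl, norm_neg, norm_one] at hle
    exact lt_irrefl _ hle
  rw [sub_add_sub_cancel, sub_eq_add_neg, Complex.exp_add, Complex.exp_sum, mul_comm]
  simp only [Complex.exp_log (hne _)]

end Limits

/-! ### The normalized number of events -/

/-- The law of `(n - L) / √L` when `n` has law `ρ`, for a count `n` of mean and variance
close to `L`. -/
noncomputable def normalizedLaw (ρ : Measure ℕ) (L : ℝ) : Measure ℝ :=
  ρ.map fun n : ℕ => (n - L) / √L

lemma integral_normalizedLaw {E : Type*} [NormedAddCommGroup E] [NormedSpace ℝ E] (ρ : Measure ℕ)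
    (L : ℝ) {g : ℝ → E} (hg : Continuous g) :
    ∫ x, g x ∂normalizedLaw ρ L = ∫ n : ℕ, g ((n - L) / √L) ∂ρ :=
  integral_map Measurable.of_discrete.aemeasurable hg.aestronglyMeasurable

instance (ρ : Measure ℕ) [IsFiniteMeasure ρ] (L : ℝ) : IsFiniteMeasure (normalizedLaw ρ L) :=
  Measure.isFiniteMeasure_map _ _

lemma complexMGF_normalizedLaw (ρ : Measure ℕ) {L : ℝ} (hL : 0 < L) (z : ℂ) :
    complexMGF id (normalizedLaw ρ L) z
      = Complex.exp (-(z * √L)) * ∫ n : ℕ, Complex.exp (z / √L * n) ∂ρ := by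
  have hs : (√L : ℂ) ≠ 0 := Complex.ofReal_ne_zero.2 (Real.sqrt_pos.2 hL).ne'
  have hL' : (L : ℂ) = (√L : ℂ) ^ 2 := by rw [← Complex.ofReal_pow, Real.sq_sqrt hL.le]
  rw [complexMGF, integral_normalizedLaw ρ L (by fun_prop), ← integral_const_mul]
  congr 1 with n
  rw [← Complex.exp_add]
  congr 1
  simp only [id_eq, Complex.ofReal_div, Complex.ofReal_sub, Complex.ofReal_natCast, hL']
  field_simp
  ring

section Limits

variable {α Ω P : Type*} [MeasurableSpace Ω] {F : Filter α} {L : α → ℝ} {T : α → Finset P}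
  {lam : P → ℝ} {E : P → Set Ω}

lemma tendsto_complexMGF_normalizedLaw_eventCount {μ : Measure Ω} [IsFiniteMeasure μ]
    (hE : ∀ l, MeasurableSet (E l)) (hind : iIndepSet E μ) (hμE : ∀ l, μ.real (E l) = lam l)
    (hL : Tendsto L F atTop) (hlam : ∀ l, lam l ∈ Set.Icc 0 1)
    (hsum : (fun a => ∑ l ∈ T a, lam l - L a) =o[F] fun a => √(L a))
    (hsq : (fun a => ∑ l ∈ T a, lam l ^ 2) =o[F] fun a => √(L a)) (z : ℂ) :
    Tendsto (fun a => complexMGF id (normalizedLaw (μ.map (eventCount E (T a))) (L a)) z) F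
      (𝓝 (Complex.exp (z ^ 2 / 2))) := by
  refine (tendsto_exp_neg_mul_prod_one_add hL hlam hsum hsq z).congr' ?_
  filter_upwards [hL.eventually_gt_atTop 0] with a ha
  simp only [complexMGF_normalizedLaw _ ha, integral_exp_mul_map_eventCount hE hind, hμE]

lemma tendsto_integral_pow_normalizedLaw_sub {ρ σ : α → Measure ℕ} (hL : Tendsto L F atTop) {k : ℕ}
    (h : Tendsto (fun a => ∫ n : ℕ, ((n : ℝ) - L a) ^ k ∂ρ a - ∫ n : ℕ, ((n : ℝ) - L a) ^ k ∂σ a)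
      F (𝓝 0)) :
    Tendsto (fun a => ∫ x, x ^ k ∂normalizedLaw (ρ a) (L a)
      - ∫ x, x ^ k ∂normalizedLaw (σ a) (L a)) F (𝓝 0) := by
  have hs : Tendsto (fun a => (√(L a))⁻¹) F (𝓝 0) :=
    tendsto_inv_atTop_zero.comp (Real.tendsto_sqrt_atTop.comp hL)
  have hlim := (hs.pow k).mul h
  rw [mul_zero] at hlim
  refine hlim.congr fun a => ?_
  simp only [integral_normalizedLaw _ _ (continuous_pow k), div_pow, integral_div]
  rw [inv_pow]
  ring

lemma integrable_normalizedLaw_eventCount {μ : Measure Ω} [IsFiniteMeasure μ]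
    (hE : ∀ l, MeasurableSet (E l)) (T : Finset P) (L : ℝ) {g : ℝ → ℝ} (hg : Continuous g) :
    Integrable g (normalizedLaw (μ.map (eventCount E T)) L) :=
  (integrable_map_measure hg.aestronglyMeasurable Measurable.of_discrete.aemeasurable).2
    (integrable_map_eventCount hE T _)

lemma memLp_id_normalizedLaw_eventCount {μ : Measure Ω} [IsFiniteMeasure μ]
    (hE : ∀ l, MeasurableSet (E l)) (T : Finset P) (L : ℝ) (n : ℕ) :
    MemLp id n (normalizedLaw (μ.map (eventCount E T)) L) := by
  have h : integrableExpSet id (normalizedLaw (μ.map (eventCount E T)) L) = Set.univ :=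
    Set.eq_univ_of_forall fun s => integrable_normalizedLaw_eventCount hE T L (by fun_prop)
  exact memLp_of_mem_interior_integrableExpSet (by simp [h]) (n : NNReal)

lemma measureReal_iInter_comp {μ : Measure Ω} (hind : iIndepSet E μ) {u : ℕ} {l : Fin u → P}
    (hl : Function.Injective l) : μ.real (⋂ j, E (l j)) = ∏ j, μ.real (E (l j)) := by
  have h := (hind.precomp hl).meas_biInter Finset.univ
  simp only [Finset.mem_univ, Set.iInter_true, Function.comp_apply] at h
  rw [measureReal_def, h, ENNReal.toReal_prod]
  rfl

theorem tendsto_charFun_normalizedLaw_eventCount {μ : α → Measure Ω} (hL : Tendsto L F atTop)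
    (hlam : ∀ l, lam l ∈ Set.Icc 0 1)
    (hsum : (fun a => ∑ l ∈ T a, lam l - L a) =o[F] fun a => √(L a))
    (hsq : (fun a => ∑ l ∈ T a, lam l ^ 2) =o[F] fun a => √(L a))
    (hE : ∀ l, MeasurableSet (E l)) (hμ : ∀ᶠ a in F, IsFiniteMeasure (μ a))
    (herr : ∀ u : ℕ, SuperpolynomialDecay F L fun a =>
      ∑ l ∈ injTuples (T a) u, |(μ a).real (⋂ j, E (l j)) - ∏ j, lam (l j)|) (t : ℝ) :
    Tendsto (fun a => charFun (normalizedLaw ((μ a).map (eventCount E (T a))) (L a)) t) F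
      (𝓝 (charFun (gaussianReal 0 1) t)) := by
  obtain ⟨Ω', _, ν, E', hν, hE', hind, hνE⟩ := exists_iIndepSet_real_eq hlam
  have hmgf := tendsto_complexMGF_normalizedLaw_eventCount (L := L) hE' hind hνE hL hlam hsum hsq
  have hfact : ∀ u : ℕ, SuperpolynomialDecay F L fun a =>
      ∫ n : ℕ, (n.descFactorial u : ℝ) ∂(μ a).map (eventCount E (T a))
        - ∫ n : ℕ, (n.descFactorial u : ℝ) ∂ν.map (eventCount E' (T a)) := fun u => by
    refine (herr u).trans_eventually_abs_le ?_
    filter_upwards [hμ] with a ha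
    simp only [Function.comp_apply]
    rw [integral_descFactorial_map_eventCount hE, integral_descFactorial_map_eventCount hE',
      ← Finset.sum_sub_distrib]
    refine (Finset.abs_sum_le_sum_abs _ _).trans (le_of_eq_of_le ?_ (le_abs_self _))
    refine Finset.sum_congr rfl fun l hl => ?_
    simp only [measureReal_iInter_comp hind (mem_injTuples.1 hl).2, hνE]
  have hmom := superpolynomialDecay_integral_sub_pow_sub
    (hμ.mono fun a _ u => integrable_map_eventCount hE (T a) _)
    (.of_forall fun a u => integrable_map_eventCount hE' (T a) _) hfact
  have hdiff := tendsto_charFun_sub_of_tendsto_moment_sub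
    (hμ.mono fun a _ => inferInstance)
    (.of_forall fun a => inferInstance)
    (hμ.mono fun a _ => memLp_id_normalizedLaw_eventCount hE (T a) (L a))
    (.of_forall fun a s => integrable_normalizedLaw_eventCount hE' (T a) (L a) (by fun_prop))
    (fun k => tendsto_integral_pow_normalizedLaw_sub hL (by simpa using hmom k 0))
    (fun s => ?_) t
  · have hmodel := hmgf (t * Complex.I)
    simp only [complexMGF_id_mul_I] at hmodel
    have hgauss : charFun (gaussianReal 0 1) t = Complex.exp ((t * Complex.I) ^ 2 / 2) := by
      rw [charFun_gaussianReal, mul_pow, Complex.I_sq]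
      simp [neg_div]
    rw [hgauss]
    simpa using hdiff.add hmodel
  · have h := (Complex.continuous_re.tendsto _).comp (hmgf s)
    simp only [complexMGF_ofReal] at h
    exact h.isBoundedUnder_le

end Limits

/-! ### From characteristic functions to distribution functions -/

lemma gaussianReal_real_Iic (γ : ℝ) : (gaussianReal 0 1).real (Set.Iic γ) = Phi γ := by
  rw [Measure.real, gaussianReal_apply_eq_integral 0 one_ne_zero, ENNReal.toReal_ofReal
    (integral_nonneg fun x => gaussianPDFReal_nonneg 0 1 x), Phi, ← integral_const_mul]
  refine integral_congr_ae (.of_forall fun u => ?_)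
  simp [gaussianPDFReal]

lemma gaussianReal_frontier_Iic (γ : ℝ) : gaussianReal 0 1 (frontier (Set.Iic γ)) = 0 := by
  have := nullSingletonClass_gaussianReal (μ := 0) (v := 1) one_ne_zero
  rw [frontier_Iic, measure_singleton]

lemma continuous_Phi : Continuous Phi := by
  have hint : Integrable fun u : ℝ => Real.exp (-u ^ 2 / 2) :=
    (integrable_exp_neg_mul_sq (half_pos one_pos)).congr
      (.of_forall fun u => congrArg Real.exp (by ring))
  have h : Phi = fun γ => 1 / √(2 * Real.pi) * ((∫ u in Set.Iic 0, Real.exp (-u ^ 2 / 2))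
      + ∫ u in (0 : ℝ)..γ, Real.exp (-u ^ 2 / 2)) := by
    ext γ
    rw [Phi, ← intervalIntegral.integral_Iic_sub_Iic hint.integrableOn hint.integrableOn,
      add_sub_cancel]
  rw [h]
  exact continuous_const.mul (continuous_const.add
    (intervalIntegral.continuous_primitive (fun _ _ => hint.intervalIntegrable) 0))

lemma tendsto_real_Iic_of_tendsto_charFun_seq {μ : ℕ → Measure ℝ}
    (hμ : ∀ n, IsProbabilityMeasure (μ n))
    (h : ∀ t, Tendsto (fun n => charFun (μ n) t) atTop (𝓝 (charFun (gaussianReal 0 1) t)))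
    (γ : ℝ) : Tendsto (fun n => (μ n).real (Set.Iic γ)) atTop (𝓝 (Phi γ)) := by
  have hconv := ProbabilityMeasure.tendsto_of_tendsto_charFun (μ := fun n => ⟨μ n, hμ n⟩)
    (μ₀ := ⟨gaussianReal 0 1, inferInstance⟩) h
  rw [← gaussianReal_real_Iic]
  exact (ENNReal.tendsto_toReal (measure_ne_top _ _)).comp
    (ProbabilityMeasure.tendsto_measure_of_null_frontier_of_tendsto' hconv
      (gaussianReal_frontier_Iic γ))

lemma tendsto_real_Iic_of_tendsto_charFun {α : Type*} {F : Filter α} [F.IsCountablyGenerated]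
    {μ : α → Measure ℝ} (hμ : ∀ᶠ a in F, IsProbabilityMeasure (μ a))
    (h : ∀ t, Tendsto (fun a => charFun (μ a) t) F (𝓝 (charFun (gaussianReal 0 1) t))) (γ : ℝ) :
    Tendsto (fun a => (μ a).real (Set.Iic γ)) F (𝓝 (Phi γ)) := by
  refine tendsto_of_seq_tendsto fun x hx => ?_
  obtain ⟨k, hk⟩ := eventually_atTop.1 (hx.eventually hμ)
  have hxk : Tendsto (fun n => x (n + k)) atTop F := hx.comp (tendsto_add_atTop_nat k)
  exact (tendsto_add_atTop_iff_nat k).1 <| tendsto_real_Iic_of_tendsto_charFun_seq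
    (fun n => hk (n + k) (Nat.le_add_left k n)) (fun t => (h t).comp hxk) γ

lemma tendsto_real_of_tendsto_real_compl {α Ω : Type*} [MeasurableSpace Ω] {F : Filter α}
    {μ : α → Measure Ω} (hμ : ∀ᶠ a in F, IsFiniteMeasure (μ a)) {Z : α → Ω → ℝ}
    {A : α → Set Ω} {G : ℝ → ℝ} {γ : ℝ} (hG : ContinuousAt G γ)
    (hZ : ∀ c, Tendsto (fun a => (μ a).real {ω | Z a ω ≤ c}) F (𝓝 (G c)))
    (hA : ∀ ε > 0, Tendsto (fun a => (μ a).real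
      {ω | (Z a ω ≤ γ - ε → ω ∈ A a) ∧ (ω ∈ A a → Z a ω ≤ γ + ε)}ᶜ) F (𝓝 0)) :
    Tendsto (fun a => (μ a).real (A a)) F (𝓝 (G γ)) := by
  rw [Metric.tendsto_nhds]
  intro η hη
  obtain ⟨δ, hδ, hcont⟩ := Metric.continuousAt_iff.1 hG (η / 3) (by positivity)
  have hlow := hcont (x := γ - δ / 2) (by simpa [Real.dist_eq, abs_of_pos hδ] using half_lt_self hδ)
  have hupp := hcont (x := γ + δ / 2) (by simpa [Real.dist_eq, abs_of_pos hδ] using half_lt_self hδ)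
  have hZlow := Metric.tendsto_nhds.1 (hZ (γ - δ / 2)) (η / 3) (by positivity)
  have hZupp := Metric.tendsto_nhds.1 (hZ (γ + δ / 2)) (η / 3) (by positivity)
  have hdev := Metric.tendsto_nhds.1 (hA (δ / 2) (by positivity)) (η / 3) (by positivity)
  filter_upwards [hμ, hZlow, hZupp, hdev] with a _ hal hau had
  set B := {ω | (Z a ω ≤ γ - δ / 2 → ω ∈ A a) ∧ (ω ∈ A a → Z a ω ≤ γ + δ / 2)}
  have hle : (μ a).real (A a) ≤ (μ a).real {ω | Z a ω ≤ γ + δ / 2} + (μ a).real Bᶜ := by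
    refine (measureReal_mono fun ω hω => ?_).trans (measureReal_union_le _ _)
    exact or_iff_not_imp_right.2 fun hB => (Set.notMem_compl_iff.1 hB).2 hω
  have hge : (μ a).real {ω | Z a ω ≤ γ - δ / 2} ≤ (μ a).real (A a) + (μ a).real Bᶜ := by
    refine (measureReal_mono fun ω hω => ?_).trans (measureReal_union_le _ _)
    exact or_iff_not_imp_right.2 fun hB => (Set.notMem_compl_iff.1 hB).1 hω
  rw [Real.dist_eq, abs_lt] at *
  constructor <;> linarith [hlow.1, hlow.2, hupp.1, hupp.2]

theorem tendsto_real_eventCount_le {α Ω P : Type*} [MeasurableSpace Ω] {F : Filter α}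
    [F.IsCountablyGenerated] {L : α → ℝ} {T : α → Finset P} {lam : P → ℝ} {E : P → Set Ω}
    {μ : α → Measure Ω} (hL : Tendsto L F atTop)
    (hlam : ∀ l, lam l ∈ Set.Icc 0 1)
    (hsum : (fun a => ∑ l ∈ T a, lam l - L a) =o[F] fun a => √(L a))
    (hsq : (fun a => ∑ l ∈ T a, lam l ^ 2) =o[F] fun a => √(L a))
    (hE : ∀ l, MeasurableSet (E l)) (hμ : ∀ᶠ a in F, IsProbabilityMeasure (μ a))
    (herr : ∀ u : ℕ, SuperpolynomialDecay F L fun a =>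
      ∑ l ∈ injTuples (T a) u, |(μ a).real (⋂ j, E (l j)) - ∏ j, lam (l j)|) (c : ℝ) :
    Tendsto (fun a => (μ a).real {ω | (eventCount E (T a) ω - L a) / √(L a) ≤ c}) F
      (𝓝 (Phi c)) := by
  have hmeas : ∀ a, Measurable (eventCount E (T a)) := fun a => measurable_eventCount hE (T a)
  have hprob : ∀ᶠ a in F,
      IsProbabilityMeasure (normalizedLaw ((μ a).map (eventCount E (T a))) (L a)) := by
    filter_upwards [hμ] with a _
    have := Measure.isProbabilityMeasure_map (μ := μ a) (hmeas a).aemeasurable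
    exact Measure.isProbabilityMeasure_map Measurable.of_discrete.aemeasurable
  refine (tendsto_real_Iic_of_tendsto_charFun hprob (tendsto_charFun_normalizedLaw_eventCount hL
    hlam hsum hsq hE (hμ.mono fun a _ => inferInstance) herr) c).congr fun a => ?_
  rw [normalizedLaw, map_measureReal_apply Measurable.of_discrete measurableSet_Iic,
    map_measureReal_apply (hmeas a) .of_discrete]
  rfl

/-! ### Elements of bounded norm -/

lemma tendsto_ratCast_toInfty (X : Set ℚ) :
    Tendsto (fun x : ℚ => (x : ℝ)) (toInfty X) atTop :=
  (tendsto_ratCast_atTop_iff.2 tendsto_id).mono_left inf_le_left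

lemma tendsto_log_log_toInfty (X : Set ℚ) :
    Tendsto (fun x : ℚ => Real.log (Real.log (x : ℝ))) (toInfty X) atTop :=
  Real.tendsto_log_atTop.comp (Real.tendsto_log_atTop.comp (tendsto_ratCast_toInfty X))

instance (X : Set ℚ) : (toInfty X).IsCountablyGenerated := by
  unfold toInfty
  infer_instance

lemma isLittleO_rpow_id {θ : ℝ} (hθ : θ < 1) : (fun x : ℝ => x ^ θ) =o[atTop] id := by
  refine isLittleO_of_tendsto' ?_ ((tendsto_rpow_neg_atTop (sub_pos.2 hθ)).congr' ?_)
  · filter_upwards [eventually_gt_atTop 0] with x hx h0 using absurd h0 hx.ne'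
  · filter_upwards [eventually_gt_atTop 0] with x hx
    rw [neg_sub, Real.rpow_sub_one hx.ne', id]

section Norm

variable {P : Type*} {N : P → ℕ} {S : Set (P →₀ ℕ)}

lemma finite_norm_le {X : Set ℚ} [(toInfty X).NeBot] {κ θ : ℝ} (hκ : 0 < κ) (hθ : θ < 1)
    (hstar : (fun x : ℚ => ({m : P →₀ ℕ | (norm N m : ℝ) ≤ x}.ncard : ℝ) - κ * x)
      =O[toInfty X] fun x : ℚ => (x : ℝ) ^ θ) (t : ℝ) :
    {m : P →₀ ℕ | (norm N m : ℝ) ≤ t}.Finite := by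
  have hcast := tendsto_ratCast_toInfty X
  have hstar' := hstar.trans_isLittleO ((isLittleO_rpow_id hθ).comp_tendsto hcast)
  obtain ⟨x, hx, hx0, hxt⟩ := ((hstar'.bound (half_pos hκ)).and
    ((hcast.eventually_gt_atTop 0).and (hcast.eventually_ge_atTop t))).exists
  rw [Real.norm_eq_abs, Function.comp_apply, id, Real.norm_of_nonneg hx0.le] at hx
  have hpos : (0 : ℝ) < {m : P →₀ ℕ | (norm N m : ℝ) ≤ x}.ncard := by
    linarith [(abs_le.1 hx).1, mul_pos hκ hx0]
  exact (Set.finite_of_ncard_pos (Nat.cast_pos.1 hpos)).subset fun m hm => le_trans hm hxt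

lemma norm_single_one (N : P → ℕ) (l : P) : norm N (Finsupp.single l 1) = N l := by
  simp [norm]

lemma finite_le_of_finite_norm_le {t : ℝ} (h : {m : P →₀ ℕ | (norm N m : ℝ) ≤ t}.Finite) :
    {l : P | (N l : ℝ) ≤ t}.Finite := by
  refine (h.preimage (Finsupp.single_left_injective one_ne_zero).injOn
    (f := fun l => Finsupp.single l 1)).subset fun l hl => ?_
  simpa [norm_single_one] using hl

lemma eventually_nonempty_upTo (N : P → ℕ) (hS : S.Nonempty) (X : Set ℚ) :
    ∀ᶠ x : ℚ in toInfty X, (upTo N S x).Nonempty := by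
  obtain ⟨m, hm⟩ := hS
  filter_upwards [(tendsto_ratCast_toInfty X).eventually_ge_atTop (norm N m : ℝ)] with x hx
  exact ⟨⟨m, hm⟩, hx⟩

end Norm

/-! ### Proportions as probabilities -/

lemma uniformOn_real {Ω : Type*} [MeasurableSpace Ω] [DiscreteMeasurableSpace Ω] (s t : Set Ω) :
    (uniformOn s).real t = ((s ∩ t).ncard : ℝ) / s.ncard := by
  have h : ∀ s : Set Ω, (Measure.count s).toReal = s.ncard := fun s => by
    rw [Measure.count_apply .of_discrete, Set.ncard]
    cases s.encard <;> simp
  rw [Measure.real, uniformOn, cond_apply .of_discrete, ENNReal.toReal_mul, ENNReal.toReal_inv, h,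
    h, inv_mul_eq_div]

lemma uniformOn_real_le_of_inter_subset {Ω : Type*} [MeasurableSpace Ω]
    [DiscreteMeasurableSpace Ω] {s t u : Set Ω} (hs : s.Finite) (h : s ∩ t ⊆ u) :
    (uniformOn s).real t ≤ (uniformOn s).real u := by
  rw [uniformOn_real, uniformOn_real]
  exact div_le_div_of_nonneg_right (Nat.cast_le.2 (Set.ncard_le_ncard
    (Set.subset_inter Set.inter_subset_left h) (hs.inter_of_left u))) (Nat.cast_nonneg _)

local instance {P : Type*} (S : Set (P →₀ ℕ)) : MeasurableSpace S := ⊤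

local instance {P : Type*} (S : Set (P →₀ ℕ)) : DiscreteMeasurableSpace S := ⟨fun _ => trivial⟩

/-- The event that `ℓ` divides the random element `g` of the free abelian monoid, expressed by the
coefficient of `ℓ` being positive as in `err`. -/
def dvdEvent {Ω P : Type*} (g : Ω → P →₀ ℕ) (l : P) : Set Ω :=
  {ω | 1 ≤ g ω l}

section Proportion

variable {P : Type*} {N : P → ℕ} {S : Set (P →₀ ℕ)} {f : S → P →₀ ℕ} {lam : P → ℝ} {X : Set ℚ}

lemma proportion_eq_uniformOn_real (N : P → ℕ) (S : Set (P →₀ ℕ)) (t : ℝ) (p : S → Prop) :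
    proportion N S t p = (uniformOn (upTo N S t)).real {m | p m} :=
  (uniformOn_real _ _).symm

lemma err_eq_uniformOn_real_sub {u : ℕ} (l : Fin u → P) (t : ℝ) :
    err N S f lam l t
      = (uniformOn (upTo N S t)).real (⋂ i, dvdEvent f (l i)) - ∏ i, lam (l i) := by
  simp only [err, proportion_eq_uniformOn_real, dvdEvent, Set.ofPred_forall]

lemma err_const_eq_uniformOn_real_sub (l : P) (t : ℝ) :
    err N S f lam (fun _ : Fin 1 => l) t
      = (uniformOn (upTo N S t)).real (dvdEvent f l) - lam l := by
  rw [err_eq_uniformOn_real_sub, Set.iInter_const, Fin.prod_univ_one]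

lemma tendsto_uniformOn_real_norm_le_rpow (hfin : ∀ t, (upTo N S t).Finite)
    (hS : (fun x : ℚ => ((upTo N S ((x : ℝ) ^ (1 / 2 : ℝ))).ncard : ℝ))
      =o[toInfty X] fun x : ℚ => ((upTo N S x).ncard : ℝ)) :
    Tendsto (fun x : ℚ => (uniformOn (upTo N S x)).real (upTo N S ((x : ℝ) ^ (1 / 2 : ℝ))))
      (toInfty X) (𝓝 0) := by
  refine squeeze_zero (fun _ => measureReal_nonneg) (fun x => ?_) hS.tendsto_div_nhds_zero
  rw [uniformOn_real]
  gcongr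
  exacts [hfin _, Set.inter_subset_right]

end Proportion

/-! ### The probabilities `λ_ℓ` and the cutoff `y` -/

section Events

variable {α Ω P : Type*} [MeasurableSpace Ω] {F : Filter α} {E : P → Set Ω} {μ : α → Measure Ω}

lemma mem_Icc_of_tendsto_sum_injTuples [F.NeBot] {T : α → Finset P} {lam : P → ℝ} {l : P}
    (hμ : ∀ᶠ a in F, IsProbabilityMeasure (μ a)) (hl : ∀ᶠ a in F, l ∈ T a)
    (h : Tendsto (fun a => ∑ l ∈ injTuples (T a) 1, |(μ a).real (⋂ j, E (l j)) - ∏ j, lam (l j)|)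
      F (𝓝 0)) : lam l ∈ Set.Icc 0 1 := by
  have hlim : Tendsto (fun a => (μ a).real (E l)) F (𝓝 (lam l)) := by
    rw [tendsto_iff_norm_sub_tendsto_zero]
    refine squeeze_zero' (.of_forall fun _ => norm_nonneg _) ?_ h
    filter_upwards [hl] with a ha
    have hmem : (fun _ => l) ∈ injTuples (T a) 1 :=
      mem_injTuples.2 ⟨fun _ => ha, Function.injective_of_subsingleton _⟩
    simpa [Set.iInter_const] using Finset.single_le_sum
      (f := fun l : Fin 1 → P => |(μ a).real (⋂ j, E (l j)) - ∏ j, lam (l j)|)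
      (fun _ _ => abs_nonneg _) hmem
  exact isClosed_Icc.mem_of_tendsto hlim
    (hμ.mono fun a _ => ⟨measureReal_nonneg, measureReal_le_one⟩)

lemma tendsto_atTop_of_sub_isLittleO_sqrt {L g : α → ℝ} (hL : Tendsto L F atTop)
    (h : (fun a => g a - L a) =o[F] fun a => √(L a)) : Tendsto g F atTop := by
  have hequiv : IsEquivalent F g L := by
    refine h.trans_isBigO (.of_bound 1 ?_)
    filter_upwards [hL.eventually_ge_atTop 1] with a ha
    rw [one_mul, Real.norm_of_nonneg (Real.sqrt_nonneg _), Real.norm_of_nonneg (by linarith)]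
    exact Real.sqrt_le_self_iff.2 (Or.inr ha)
  exact hequiv.symm.tendsto_atTop hL

lemma tendsto_atTop_of_tendsto_sum {N : P → ℕ} (hP : ∀ t : ℝ, {l : P | (N l : ℝ) ≤ t}.Finite)
    {lam : P → ℝ} {y : α → ℝ}
    (h : Tendsto (fun a => ∑ l ∈ (hP (y a)).toFinset, lam l) F atTop) : Tendsto y F atTop := by
  refine tendsto_atTop.2 fun b => ?_
  filter_upwards [h.eventually_gt_atTop (∑ l ∈ (hP b).toFinset, |lam l|)] with a ha
  contrapose! ha
  refine (Finset.sum_le_sum fun l _ => le_abs_self (lam l)).trans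
    (Finset.sum_le_sum_of_subset_of_nonneg ?_ fun l _ _ => abs_nonneg _)
  exact Set.Finite.toFinset_mono fun l hl => le_trans hl ha.le

end Events

/-! ### The number of divisors -/

section Omega

variable {Ω P : Type*}

lemma eventCount_dvdEvent_le_omega (g : Ω → P →₀ ℕ) (T : Finset P) (ω : Ω) :
    eventCount (dvdEvent g) T ω ≤ omega (g ω) := by
  classical
  refine Finset.card_le_card fun l hl => ?_
  exact Finsupp.mem_support_iff.2 (Nat.one_le_iff_ne_zero.1 (Finset.mem_filter.1 hl).2)

lemma omega_le_eventCount_add {N : P → ℕ} {T U : Finset P} {b : ℝ}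
    (hTU : ∀ l, (N l : ℝ) ≤ b → l ∈ T ∨ l ∈ U) (g : Ω → P →₀ ℕ) (ω : Ω) :
    omega (g ω) ≤ eventCount (dvdEvent g) T ω + eventCount (dvdEvent g) U ω
      + {l : P | b < (N l : ℝ) ∧ 1 ≤ g ω l}.ncard := by
  classical
  have hfin : {l : P | b < (N l : ℝ) ∧ 1 ≤ g ω l}.Finite :=
    (g ω).support.finite_toSet.subset fun l hl =>
      Finsupp.mem_support_iff.2 (Nat.one_le_iff_ne_zero.1 hl.2)
  rw [Set.ncard_eq_toFinset_card _ hfin, eventCount, eventCount]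
  refine le_trans (Finset.card_le_card fun l hl => ?_)
    ((Finset.card_union_le _ _).trans (Nat.add_le_add_right (Finset.card_union_le _ _) _))
  have hl1 : 1 ≤ g ω l := Nat.one_le_iff_ne_zero.2 (Finsupp.mem_support_iff.1 hl)
  rw [Finset.mem_union, Finset.mem_union, Finset.mem_filter, Finset.mem_filter, hfin.mem_toFinset]
  exact (le_or_gt (N l : ℝ) b).imp (fun h => (hTU l h).imp (⟨·, hl1⟩) (⟨·, hl1⟩)) (⟨·, hl1⟩)

end Omega

/-! ### Replacing `log log x` by `log log N(m)` -/

lemma three_lt_of_rpow_half_lt {x n : ℝ} (hx : 9 ≤ x) (hn : x ^ (1 / 2 : ℝ) < n) : 3 < n := by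
  refine lt_of_le_of_lt ?_ hn
  rw [← Real.sqrt_eq_rpow]
  exact Real.le_sqrt_of_sq_le (by linarith)

lemma log_log_pos_of_three_lt {n : ℝ} (hn : 3 < n) : 0 < Real.log (Real.log n) :=
  Real.log_pos ((Real.lt_log_iff_exp_lt (by linarith)).2 (Real.exp_one_lt_three.trans hn))

lemma log_log_le_log_log_add_one {x n : ℝ} (hx : 1 < x) (hn : x ^ (1 / 2 : ℝ) < n) :
    Real.log (Real.log x) ≤ Real.log (Real.log n) + 1 := by
  have hx0 : 0 < x := zero_lt_one.trans hx
  have hlx : 0 < Real.log x := Real.log_pos hx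
  have hhalf : 1 / 2 * Real.log x ≤ Real.log n := by
    rw [← Real.log_rpow hx0]
    exact Real.log_le_log (Real.rpow_pos_of_pos hx0 _) hn.le
  have hlog := Real.log_le_log (by positivity) hhalf
  rw [Real.log_mul (by norm_num) hlx.ne', one_div, Real.log_inv] at hlog
  linarith [Real.log_two_lt_d9]

lemma abs_mul_sqrt_sub_mul_sqrt_le {M L : ℝ} (γ : ℝ) (hM : 0 ≤ M) (hML : M ≤ L)
    (hLM : L ≤ M + 1) : |γ * √L - γ * √M| ≤ |γ| := by
  have hle : √M ≤ √L := Real.sqrt_le_sqrt hML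
  have hge : √L ≤ √M + 1 := by
    rw [Real.sqrt_le_left (by positivity)]
    linarith [add_sq (√M) 1, Real.sq_sqrt hM, Real.sqrt_nonneg M]
  rw [← mul_sub, abs_mul]
  exact mul_le_of_le_one_right (abs_nonneg γ) (abs_le.2 ⟨by linarith, by linarith⟩)

lemma sub_div_sqrt_le_of_abs_sub_le {M L W w γ ε : ℝ} (hM : 0 < M) (hML : M ≤ L)
    (hLM : L ≤ M + 1) (h : |w - W| + 1 + |γ| ≤ ε * √L) :
    ((W - L) / √L ≤ γ - ε → (w - M) / √M ≤ γ) ∧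
      ((w - M) / √M ≤ γ → (W - L) / √L ≤ γ + ε) := by
  have hγ := abs_le.1 (abs_mul_sqrt_sub_mul_sqrt_le γ hM.le hML hLM)
  have hw := abs_le.1 (le_refl |w - W|)
  rw [div_le_iff₀ (Real.sqrt_pos.2 hM), div_le_iff₀ (Real.sqrt_pos.2 (hM.trans_le hML)),
    div_le_iff₀ (Real.sqrt_pos.2 (hM.trans_le hML))]
  constructor <;> intro h' <;> linarith

/-- The event in the theorem: `N(m) ≥ 3`, so that `log log N(m)` is positive, and the normalized
`ω(f(m))` is at most `γ`. -/
def normalizedOmegaLE {P : Type*} (N : P → ℕ) {S : Set (P →₀ ℕ)} (f : S → P →₀ ℕ) (γ : ℝ) : Set S :=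
  {m | 3 ≤ norm N (m : P →₀ ℕ) ∧
    ((omega (f m) : ℝ) - Real.log (Real.log (norm N (m : P →₀ ℕ))))
      / √(Real.log (Real.log (norm N (m : P →₀ ℕ)))) ≤ γ}

section Limit

variable {P : Type*} {N : P → ℕ} {S : Set (P →₀ ℕ)} {f : S → P →₀ ℕ} {lam : P → ℝ} {X : Set ℚ}
  {y : ℚ → ℝ}

lemma eventually_isProbabilityMeasure_uniformOn_upTo (hfin : ∀ t, (upTo N S t).Finite)
    (hS : S.Nonempty) (X : Set ℚ) :
    ∀ᶠ x : ℚ in toInfty X, IsProbabilityMeasure (uniformOn (upTo N S x)) :=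
  (eventually_nonempty_upTo N hS X).mono fun _ hx => isProbabilityMeasure_uniformOn (hfin _) hx

lemma finsum_mem_injective_eq_sum_injTuples (hP : ∀ t : ℝ, {l : P | (N l : ℝ) ≤ t}.Finite) (t : ℝ)
    {u : ℕ} (g : (Fin u → P) → ℝ) :
    ∑ᶠ l ∈ {l : Fin u → P | Function.Injective l ∧ ∀ i, (N (l i) : ℝ) ≤ t}, g l
      = ∑ l ∈ injTuples (hP t).toFinset u, g l := by
  have hset : {l : Fin u → P | Function.Injective l ∧ ∀ i, (N (l i) : ℝ) ≤ t}
      = injTuples (hP t).toFinset u := by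
    ext l
    simp [mem_injTuples, and_comm]
  rw [hset, finsum_mem_coe_finset]

lemma tendsto_uniformOn_real_eventCount_le (hS : S.Nonempty) (hfin : ∀ t, (upTo N S t).Finite)
    (hP : ∀ t : ℝ, {l : P | (N l : ℝ) ≤ t}.Finite)
    (hd : (fun x : ℚ => (∑ᶠ l ∈ {l : P | (N l : ℝ) ≤ y x}, lam l) - Real.log (Real.log x))
      =o[toInfty X] fun x : ℚ => √(Real.log (Real.log x)))
    (he : (fun x : ℚ => ∑ᶠ l ∈ {l : P | (N l : ℝ) ≤ y x}, lam l ^ 2)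
      =o[toInfty X] fun x : ℚ => √(Real.log (Real.log x)))
    (hf : ∀ r : ℕ, 1 ≤ r → ∀ u : ℕ, 1 ≤ u → u ≤ r →
      (fun x : ℚ => ∑ᶠ l ∈ {l : Fin u → P | Function.Injective l ∧ ∀ i, (N (l i) : ℝ) ≤ y x},
        |err N S f lam l x|)
      =o[toInfty X] fun x : ℚ => Real.log (Real.log x) ^ (-(r : ℝ) / 2)) (c : ℝ) :
    Tendsto (fun x : ℚ => (uniformOn (upTo N S x)).real
        {m | (eventCount (dvdEvent f) (hP (y x)).toFinset m - Real.log (Real.log x))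
          / √(Real.log (Real.log x)) ≤ c})
      (toInfty X) (𝓝 (Phi c)) := by
  rcases eq_or_neBot (toInfty X) with hbot | _
  · simp only [hbot, tendsto_bot]
  simp only [finsum_mem_eq_finite_toFinset_sum _ (hP _)] at hd he
  simp only [finsum_mem_injective_eq_sum_injTuples hP] at hf
  have hL := tendsto_log_log_toInfty X
  have hμ := eventually_isProbabilityMeasure_uniformOn_upTo hfin hS X
  have herr : ∀ u : ℕ, SuperpolynomialDecay (toInfty X) (fun x : ℚ => Real.log (Real.log x))
      fun x : ℚ => ∑ l ∈ injTuples (hP (y x)).toFinset u,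
        |(uniformOn (upTo N S x)).real (⋂ j, dvdEvent f (l j)) - ∏ j, lam (l j)| := by
    rintro (_ | u)
    · refine (superpolynomialDecay_zero _ _).congr' ?_
      filter_upwards [hμ] with x _
      simp
    · simp only [← err_eq_uniformOn_real_sub]
      exact superpolynomialDecay_of_isLittleO_rpow hL fun r hr =>
        hf r (Nat.one_le_of_lt hr) (u + 1) (Nat.le_add_left 1 u) hr
  have hy := tendsto_atTop_of_tendsto_sum hP (tendsto_atTop_of_sub_isLittleO_sqrt hL hd)
  have hlam : ∀ l, lam l ∈ Set.Icc 0 1 := fun l =>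
    mem_Icc_of_tendsto_sum_injTuples hμ
      ((hy.eventually_ge_atTop (N l : ℝ)).mono fun x hx => (hP (y x)).mem_toFinset.2 hx)
      (by simpa using herr 1 0)
  exact tendsto_real_eventCount_le hL hlam hd he (fun _ => .of_discrete) hμ herr c

lemma tendsto_uniformOn_real_lt_eventCount (hS : S.Nonempty) (hfin : ∀ t, (upTo N S t).Finite)
    {U : ℚ → Set P} (hU : ∀ x, (U x).Finite) {g : ℚ → ℝ} (hg : ∀ᶠ x in toInfty X, 0 < g x)
    (hb : (fun x : ℚ => ∑ᶠ l ∈ U x, lam l) =o[toInfty X] g)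
    (hc : (fun x : ℚ => ∑ᶠ l ∈ U x, |err N S f lam (fun _ : Fin 1 => l) x|) =o[toInfty X] g)
    {δ : ℝ} (hδ : 0 < δ) :
    Tendsto (fun x : ℚ => (uniformOn (upTo N S x)).real
      {m | δ * g x < eventCount (dvdEvent f) (hU x).toFinset m}) (toInfty X) (𝓝 0) := by
  simp only [finsum_mem_eq_finite_toFinset_sum _ (hU _)] at hb hc
  refine tendsto_real_lt_eventCount ((eventually_isProbabilityMeasure_uniformOn_upTo hfin hS X).mono
    fun x _ => inferInstance) (fun _ => .of_discrete) hg
    ((IsBigO.of_bound 1 (.of_forall fun x => ?_)).trans_isLittleO (hb.add hc)) hδ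
  rw [one_mul, Real.norm_of_nonneg (Finset.sum_nonneg fun _ _ => measureReal_nonneg),
    ← Finset.sum_add_distrib]
  refine (Finset.sum_le_sum fun l _ => ?_).trans (le_abs_self _)
  linarith [le_abs_self (err N S f lam (fun _ : Fin 1 => l) x),
    err_const_eq_uniformOn_real_sub (N := N) (f := f) (lam := lam) l x]

lemma normalized_eventCount_sandwich {T U : Finset P} {x b γ δ : ℝ} {C : ℕ}
    (hTU : ∀ l, (N l : ℝ) ≤ b → l ∈ T ∨ l ∈ U) {m : S} (hx : 9 ≤ x) (hmx : m ∈ upTo N S x)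
    (hm : m ∉ upTo N S (x ^ (1 / 2 : ℝ)))
    (hU : eventCount (dvdEvent f) U m ≤ δ * √(Real.log (Real.log x)))
    (hC : {l : P | b < (N l : ℝ) ∧ 1 ≤ f m l}.ncard ≤ C)
    (hsmall : C + 1 + |γ| ≤ δ * √(Real.log (Real.log x))) :
    ((eventCount (dvdEvent f) T m - Real.log (Real.log x)) / √(Real.log (Real.log x)) ≤ γ - 2 * δ →
      m ∈ normalizedOmegaLE N f γ) ∧
    (m ∈ normalizedOmegaLE N f γ →
      (eventCount (dvdEvent f) T m - Real.log (Real.log x)) / √(Real.log (Real.log x))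
        ≤ γ + 2 * δ) := by
  have hm' : x ^ (1 / 2 : ℝ) < norm N (m : P →₀ ℕ) := not_le.1 hm
  have h3 := three_lt_of_rpow_half_lt hx hm'
  have hlower : (eventCount (dvdEvent f) T m : ℝ) ≤ omega (f m) :=
    mod_cast eventCount_dvdEvent_le_omega f T m
  have hupper : (omega (f m) : ℝ)
      ≤ eventCount (dvdEvent f) T m + eventCount (dvdEvent f) U m + C :=
    mod_cast (omega_le_eventCount_add hTU f m).trans (Nat.add_le_add_left hC _)
  obtain ⟨hle, hge⟩ := sub_div_sqrt_le_of_abs_sub_le (w := omega (f m))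
    (W := eventCount (dvdEvent f) T m) (γ := γ) (ε := 2 * δ) (log_log_pos_of_three_lt h3)
    (Real.log_le_log (Real.log_pos (by linarith)) (Real.log_le_log (by linarith) hmx))
    (log_log_le_log_log_add_one (by linarith) hm')
    (by rw [abs_of_nonneg (sub_nonneg.2 hlower)]; linarith)
  exact ⟨fun h => ⟨by exact_mod_cast h3.le, hle h⟩, fun h => hge h.2⟩

end Limit

theorem _root_.theorem1p1_general {P : Type*} (N : P → ℕ)
    (hP : ∀ t : ℝ, {l : P | (N l : ℝ) ≤ t}.Finite)
    (X : Set ℚ) (S : Set (P →₀ ℕ)) (hSne : S.Nonempty) (hSfin : ∀ t, (upTo N S t).Finite)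
    (hS : (fun x : ℚ => ((upTo N S ((x : ℝ) ^ (1 / 2 : ℝ))).ncard : ℝ))
      =o[toInfty X] fun x : ℚ => ((upTo N S x).ncard : ℝ))
    (f : S → P →₀ ℕ) (lam : P → ℝ) (b y : ℚ → ℝ)
    (ha : ∃ C : ℕ, ∀ᶠ x : ℚ in toInfty X, ∀ m ∈ upTo N S x,
      {l : P | b x < (N l : ℝ) ∧ 1 ≤ f m l}.ncard ≤ C)
    (hb : (fun x : ℚ => ∑ᶠ l ∈ {l : P | y x < (N l : ℝ) ∧ (N l : ℝ) ≤ b x}, lam l)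
      =o[toInfty X] fun x : ℚ => √(Real.log (Real.log x)))
    (hc : (fun x : ℚ => ∑ᶠ l ∈ {l : P | y x < (N l : ℝ) ∧ (N l : ℝ) ≤ b x},
        |err N S f lam (fun _ : Fin 1 => l) x|)
      =o[toInfty X] fun x : ℚ => √(Real.log (Real.log x)))
    (hd : (fun x : ℚ => (∑ᶠ l ∈ {l : P | (N l : ℝ) ≤ y x}, lam l) - Real.log (Real.log x))
      =o[toInfty X] fun x : ℚ => √(Real.log (Real.log x)))
    (he : (fun x : ℚ => ∑ᶠ l ∈ {l : P | (N l : ℝ) ≤ y x}, lam l ^ 2)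
      =o[toInfty X] fun x : ℚ => √(Real.log (Real.log x)))
    (hf : ∀ r : ℕ, 1 ≤ r → ∀ u : ℕ, 1 ≤ u → u ≤ r →
      (fun x : ℚ => ∑ᶠ l ∈ {l : Fin u → P | Function.Injective l ∧ ∀ i, (N (l i) : ℝ) ≤ y x},
        |err N S f lam l x|)
      =o[toInfty X] fun x : ℚ => Real.log (Real.log x) ^ (-(r : ℝ) / 2))
    (γ : ℝ) :
    Tendsto (fun x : ℚ => proportion N S x (fun m =>
        3 ≤ norm N (m : P →₀ ℕ) ∧
        ((omega (f m) : ℝ) - Real.log (Real.log (norm N (m : P →₀ ℕ))))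
          / √(Real.log (Real.log (norm N (m : P →₀ ℕ)))) ≤ γ))
      (toInfty X) (𝓝 (Phi γ)) := by
  have hU : ∀ x, {l : P | y x < (N l : ℝ) ∧ (N l : ℝ) ≤ b x}.Finite := fun x =>
    (hP (b x)).subset fun l hl => hl.2
  have hsqrt : Tendsto (fun x : ℚ => √(Real.log (Real.log x))) (toInfty X) atTop :=
    Real.tendsto_sqrt_atTop.comp (tendsto_log_log_toInfty X)
  simp only [proportion_eq_uniformOn_real]
  refine tendsto_real_of_tendsto_real_compl
    ((eventually_isProbabilityMeasure_uniformOn_upTo hSfin hSne X).mono fun _ _ => inferInstance)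
    continuous_Phi.continuousAt (tendsto_uniformOn_real_eventCount_le hSne hSfin hP hd he hf)
    fun ε hε => ?_
  have hbad := (tendsto_uniformOn_real_norm_le_rpow hSfin hS).add
    (tendsto_uniformOn_real_lt_eventCount hSne hSfin hU (hsqrt.eventually_gt_atTop 0) hb hc
      (half_pos hε))
  rw [add_zero] at hbad
  obtain ⟨C, hC⟩ := ha
  refine squeeze_zero' (.of_forall fun _ => measureReal_nonneg) ?_ hbad
  filter_upwards [hC, hsqrt.eventually_ge_atTop ((C + 1 + |γ|) / (ε / 2)),
    (tendsto_ratCast_toInfty X).eventually_ge_atTop 9] with x hCx hsmall hx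
  refine (uniformOn_real_le_of_inter_subset (hSfin x) ?_).trans (measureReal_union_le _ _)
  rintro m ⟨hmx, hm⟩
  by_contra hgood
  obtain ⟨hnorm, hcount⟩ := not_or.1 hgood
  refine hm ?_
  have hTU : ∀ l, (N l : ℝ) ≤ b x → l ∈ (hP (y x)).toFinset ∨ l ∈ (hU x).toFinset := fun l hl => by
    simpa [hl] using le_or_gt (N l : ℝ) (y x)
  have := normalized_eventCount_sandwich hTU (γ := γ) hx hmx hnorm (not_lt.1 hcount) (hCx m hmx)
    ((div_le_iff₀' (half_pos hε)).1 hsmall)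
  rwa [mul_div_cancel₀ ε two_ne_zero] at this

end ErdosKac

theorem theorem1p1 {P : Type*} [Countable P] (N : P → ℕ) (hN : ∀ p, 1 < N p)
    -- the set `X` of admissible values of `x`
    (X : Set ℚ) (hNX : ∀ m : P →₀ ℕ, (ErdosKac.norm N m : ℚ) ∈ X)
    (hdiv : ∀ x₁ ∈ X, ∀ x₂ ∈ X, x₂ ≠ 0 → x₁ / x₂ ∈ X)
    -- the number of elements of norm at most `x` is `κ x + O(x ^ θ)`
    (κ θ : ℝ) (hκ : 0 < κ) (hθ : 0 ≤ θ) (hθ' : θ < 1)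
    (hstar : (fun x : ℚ => ({m : P →₀ ℕ | (ErdosKac.norm N m : ℝ) ≤ (x : ℝ)}.ncard : ℝ)
        - κ * (x : ℝ)) =O[ErdosKac.toInfty X] fun x : ℚ => (x : ℝ) ^ θ)
    -- the subset `S`
    (S : Set (P →₀ ℕ)) (hSinf : S.Infinite)
    (hS : (fun x : ℚ => ((ErdosKac.upTo N S ((x : ℝ) ^ (1 / 2 : ℝ))).ncard : ℝ))
      =o[ErdosKac.toInfty X] fun x : ℚ => ((ErdosKac.upTo N S (x : ℝ)).ncard : ℝ))
    (f : S → (P →₀ ℕ)) (lam : P → ℝ)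
    (β : ℝ) (hβ : 0 < β) (hβ' : β ≤ 1)
    (y : ℚ → ℝ) (hy : ∀ᶠ x : ℚ in ErdosKac.toInfty X, y x < (x : ℝ) ^ β)
    (ha : ∃ C : ℕ, ∀ᶠ x : ℚ in ErdosKac.toInfty X, ∀ m ∈ ErdosKac.upTo N S (x : ℝ),
      {l : P | (x : ℝ) ^ β < (N l : ℝ) ∧ 1 ≤ f m l}.ncard ≤ C)
    (hb : (fun x : ℚ => ∑ᶠ l ∈ {l : P | y x < (N l : ℝ) ∧ (N l : ℝ) ≤ (x : ℝ) ^ β}, lam l)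
      =o[ErdosKac.toInfty X] fun x : ℚ => Real.sqrt (Real.log (Real.log (x : ℝ))))
    (hc : (fun x : ℚ => ∑ᶠ l ∈ {l : P | y x < (N l : ℝ) ∧ (N l : ℝ) ≤ (x : ℝ) ^ β},
        |ErdosKac.err N S f lam (fun _ : Fin 1 => l) (x : ℝ)|)
      =o[ErdosKac.toInfty X] fun x : ℚ => Real.sqrt (Real.log (Real.log (x : ℝ))))
    (hd : (fun x : ℚ => (∑ᶠ l ∈ {l : P | (N l : ℝ) ≤ y x}, lam l) - Real.log (Real.log (x : ℝ)))
      =o[ErdosKac.toInfty X] fun x : ℚ => Real.sqrt (Real.log (Real.log (x : ℝ))))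
    (he : (fun x : ℚ => ∑ᶠ l ∈ {l : P | (N l : ℝ) ≤ y x}, lam l ^ 2)
      =o[ErdosKac.toInfty X] fun x : ℚ => Real.sqrt (Real.log (Real.log (x : ℝ))))
    (hf : ∀ r : ℕ, 1 ≤ r → ∀ u : ℕ, 1 ≤ u → u ≤ r →
      (fun x : ℚ => ∑ᶠ l ∈ {l : Fin u → P | Function.Injective l ∧ ∀ i, (N (l i) : ℝ) ≤ y x},
        |ErdosKac.err N S f lam l (x : ℝ)|)
      =o[ErdosKac.toInfty X] fun x : ℚ => Real.log (Real.log (x : ℝ)) ^ (-(r : ℝ) / 2))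
    (γ : ℝ) :
    Tendsto (fun x : ℚ => ErdosKac.proportion N S (x : ℝ) (fun m =>
        3 ≤ ErdosKac.norm N (m : P →₀ ℕ) ∧
        ((ErdosKac.omega (f m) : ℝ) - Real.log (Real.log (ErdosKac.norm N (m : P →₀ ℕ) : ℝ)))
          / Real.sqrt (Real.log (Real.log (ErdosKac.norm N (m : P →₀ ℕ) : ℝ))) ≤ γ))
      (ErdosKac.toInfty X) (𝓝 (ErdosKac.Phi γ)) := by
  rcases eq_or_neBot (ErdosKac.toInfty X) with hbot | _
  · simp only [hbot, tendsto_bot]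
  have hfin := ErdosKac.finite_norm_le hκ hθ' hstar
  exact theorem1p1_general N (fun t => ErdosKac.finite_le_of_finite_norm_le (hfin t)) X S
    hSinf.nonempty (fun t => (hfin t).preimage Subtype.val_injective.injOn) hS f lam _ y ha hb hc hd
    he hf γ
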